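/- **Theorem (Static solution for random erasures).** Let $G$ be a finite acyclic ADT network: every supernode $V$ has input ports $I(V)$ and output ports $O(V)$, and each link (edge) runs from an output port to an input port. Let $S$ be a source with processes $X=(X_1,\dots,X_\mu)$ and let $T_1,\dots,T_N$ be distinct destination supernodes, each of which wants all of $X$ (a multicast connection $\mathcal C$). A linear network code over $\mathbb F_q$ is a choice of coefficients $\alpha_{(k,e)},\beta_{(e',e)},\epsilon_{(e',(T_i,k))}\in\mathbb F_q$, where $1\le k\le\mu$, such that the symbols $Y$ at the ports and the outputs $Z(T_i)=(Z(T_i,1),\dots,Z(T_i,\mu))$ satisfy $$Y(e')=\sum_{e:\,(e,e')\text{ is a link}}Y(e)\quad (e'\in I(V)),$$ $$Y(e)=\sum_{e'\in I(V)}\beta_{(e',e)}Y(e')+[V=S]\sum_{k=1}^{\mu}\alpha_{(k,e)}X_k\quad (e\in O(V)),$$ $$Z(T_i,k)=\sum_{e'\in I(T_i)}\epsilon_{(e',(T_i,k))}Y(e').$$ For a set $f$ of links let $G_f$ be $G$ with the links in $f$ deleted. Say that $(G_f,\mathcal C)$ is solvable over $\mathbb F_q$ if some code over $\mathbb F_q$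 gives $Z(T_i)=X$ on $G_f$ for every $i$ and every $X\in\mathbb F_q^\mu$. A code is a *static solution* for a family of failure sets if, for every $f$ in the family, with all its coefficients (which may not depend on $f$) kept fixed, every $T_i$ can recover $X$ linearly from $Z(T_i)$ on $G_f$; that is, the $\mu\times\mu$ system matrix $M_{f,i}$ given by $Z(T_i)=X M_{f,i}$ is invertible for all $i$ and all $f$ in the family. Fix a prime $p$, and let $\mathcal F$ be the set of all sets $f$ of links of $G$ such that $(G_f,\mathcal C)$ is solvable over some finite field of characteristic $p$. Then: 1. There is a static solution for $\mathcal F$ over some finite field of characteristic $p$. 2. Whenever $\mathbb F_q$ has characteristic $p$ and $q>|\mathcal F|\,N$, there is a static solution for $\mathcal F$ over $\mathbb F_q$. 3. The same holds for solvability over the given field alone: if $\mathcal F_q$ is the set of all $f$ such that $(G_f,\mathcal C)$ is solvable over $\mathbb F_q$, and $q>|\mathcal F_q|\,N$, there is a static solution for $\mathcal F_q$ over $\mathbb F_q$. -/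

import Mathlib

/-- An ADT network: a directed graph on supernodes `V`. Every supernode owns input ports (from `I`)
and output ports (from `O`); an edge runs from an output port to an input port. -/
structure ADTNetwork (V I O : Type*) where
  /-- the supernode owning an input port -/
  inNode : I → V
  /-- the supernode owning an output port -/
  outNode : O → V
  /-- the links -/
  edges : Finset (O × I)

/-- There is a link from an output port of `u` to an input port of `v`. -/
def ADTNetwork.Link {V I O : Type*} (G : ADTNetwork V I O) (u v : V) : Prop :=
  ∃ e ∈ G.edges, G.outNode e.1 = u ∧ G.inNode e.2 = v

/-- No directed cycle of supernodes. -/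
def ADTNetwork.Acyclic {V I O : Type*} (G : ADTNetwork V I O) : Prop :=
  ∀ v, ¬ Relation.TransGen G.Link v v

/-- A multicast problem: the source supernode has `rate` source processes, all of which every
destination wants. -/
structure MulticastProblem (V I O : Type*) extends ADTNetwork V I O where
  source : V
  dests : Finset V
  rate : ℕ

/-- A linear network code over `K` for `μ` source processes. The coefficient `ε i k` is the one
used by the supernode owning `i` for its `k`-th decoded process, so it needs no further index.
`β i o` is used only if `i` and `o` belong to the same supernode, and `α k o` only if `o` is
an output port of the source. -/
structure NetworkCode (I O K : Type*) (μ : ℕ) where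
  α : Fin μ → O → K
  β : I → O → K
  ε : I → Fin μ → K

namespace MulticastProblem

variable {V I O : Type*} [DecidableEq V] [Fintype I] [DecidableEq I] [Fintype O] [DecidableEq O]

/-- The same problem after the links in `f` have failed (been deleted). -/
abbrev fail (P : MulticastProblem V I O) (f : Finset (O × I)) : MulticastProblem V I O :=
  { P with edges := P.edges \ f }

/-- `yI`, `yO` are the symbols at the input and output ports when the source symbols are `x` and
the supernodes use the code `c`: symbols superpose at input ports (an output port sends the same
symbol on all its links), and output ports send linear combinations of the symbols at the input
ports of their supernode and, at the source, of the source symbols. -/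
def IsFlow {K : Type*} [Field K] (P : MulticastProblem V I O) (c : NetworkCode I O K P.rate)
    (x : Fin P.rate → K) (yI : I → K) (yO : O → K) : Prop :=
  (∀ i, yI i = ∑ o with (o, i) ∈ P.edges, yO o) ∧
  (∀ o, yO o = (∑ i with P.inNode i = P.outNode o, c.β i o * yI i) +
    (if P.outNode o = P.source then ∑ k, c.α k o * x k else 0))

/-- The processes `Z(T, k)` that supernode `T` forms from the symbols at its input ports. -/
def output {K : Type*} [Field K] (P : MulticastProblem V I O) (c : NetworkCode I O K P.rate)
    (T : V) (yI : I → K) : Fin P.rate → K :=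
  fun k => ∑ i with P.inNode i = T, c.ε i k * yI i

/-- With the code `c`, every destination's output equals the source vector, `Z(T) = X(S)`,
whatever the source vector is. (In an acyclic network the port symbols exist and are unique.) -/
def Establishes {K : Type*} [Field K] (P : MulticastProblem V I O)
    (c : NetworkCode I O K P.rate) : Prop :=
  ∀ x, (∃ yI yO, P.IsFlow c x yI yO) ∧
    ∀ yI yO, P.IsFlow c x yI yO → ∀ T ∈ P.dests, P.output c T yI = x

/-- The multicast problem is solvable over `K`. -/
def Solvable (P : MulticastProblem V I O) (K : Type*) [Field K] : Prop :=
  ∃ c : NetworkCode I O K P.rate, P.Establishes c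

/-- With the code `c`, every destination `T` can linearly decode the source vector from its
output `Z(T)`. As `Z(T) = X(S) M` for a square system matrix `M`, this says that `M` is invertible
for every destination, the decoding matrix `D` being the inverse of `M`. -/
def Decodes {K : Type*} [Field K] (P : MulticastProblem V I O)
    (c : NetworkCode I O K P.rate) : Prop :=
  ∀ T ∈ P.dests, ∃ D : Matrix (Fin P.rate) (Fin P.rate) K,
    ∀ x, (∃ yI yO, P.IsFlow c x yI yO) ∧
      ∀ yI yO, P.IsFlow c x yI yO → Matrix.vecMul (P.output c T yI) D = x

/-- The code `c`, without any change of its coefficients, achieves the multicast rate under every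
failure pattern in `𝓕`. -/
def IsStaticSolution {K : Type*} [Field K] (P : MulticastProblem V I O)
    (𝓕 : Set (Finset (O × I))) (c : NetworkCode I O K P.rate) : Prop :=
  ∀ f ∈ 𝓕, (P.fail f).Decodes c

/-- All link failure patterns under which the problem is solvable over the field `K`. -/
def solvableFailures (P : MulticastProblem V I O) (K : Type*) [Field K] :
    Set (Finset (O × I)) :=
  {f | f ⊆ P.edges ∧ (P.fail f).Solvable K}

/-- All link failure patterns under which the problem is solvable over some finite field of
characteristic `p`, of whatever size (every finite field has a copy in `Type`). -/
def solvableFailuresChar (P : MulticastProblem V I O) (p : ℕ) : Set (Finset (O × I)) :=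
  {f | f ⊆ P.edges ∧ ∃ (L : Type) (_ : Field L) (_ : Finite L) (_ : CharP L p),
    (P.fail f).Solvable L}

end MulticastProblem

open Finset Matrix

/-! For a failure set `f` and a destination `T`, the flow equations and the output of `T` form one
square linear system. In an acyclic network, a code that solves the problem makes its determinant
nonzero, and a nonzero determinant suffices for decoding at `T`. For generic coefficients this
determinant is a polynomial defined over the prime field, so whether it vanishes identically depends
only on the characteristic. Each coefficient occurs in only one row, so the polynomial has degree at
most 1 in each variable. The product over all pairs `(f, T)` is nonzero and has degree at most `|𝓕|
N` in each variable. Over a field with more elements than that it does not vanish everywhere, and a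
point where it is nonzero is a static solution. -/

/-- Each Leibniz product takes exactly one factor from row `r`, the only row where `v` can occur. -/
theorem MvPolynomial.degreeOf_det_le_one {σ n R : Type*} [Fintype n] [DecidableEq n] [CommRing R]
    (M : Matrix n n (MvPolynomial σ R)) (v : σ) (r : n)
    (h : ∀ a b, (M a b).degreeOf v ≤ if a = r then 1 else 0) : M.det.degreeOf v ≤ 1 := by
  rw [← Matrix.det_transpose, Matrix.det_apply]
  refine (degreeOf_sum_le v _ _).trans (Finset.sup_le fun s _ => ?_)
  have key : (∏ i, Mᵀ (s i) i).degreeOf v ≤ 1 := by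
    refine (degreeOf_prod_le v _ _).trans ((Finset.sum_le_sum fun i _ => h i (s i)).trans ?_)
    simp
  rcases Int.units_eq_one_or (Equiv.Perm.sign s) with hs | hs
  · simpa [hs] using key
  · simpa [hs, Units.neg_smul, degreeOf_neg] using key

/-- The variables of the generic network code: one for each coefficient. -/
abbrev CodeVar (I O : Type*) (μ : ℕ) : Type _ := (Fin μ × O) ⊕ (I × O) ⊕ (I × Fin μ)

namespace NetworkCode

variable {I O R : Type*} {μ : ℕ}

/-- The code whose coefficients are given by a function on `CodeVar`. -/
def ofFun (a : CodeVar I O μ → R) : NetworkCode I O R μ where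
  α k o := a (.inl (k, o))
  β i o := a (.inr (.inl (i, o)))
  ε i k := a (.inr (.inr (i, k)))

/-- The list of all coefficients of a code. -/
def toFun (c : NetworkCode I O R μ) : CodeVar I O μ → R :=
  Sum.elim (fun x => c.α x.1 x.2) (Sum.elim (fun x => c.β x.1 x.2) (fun x => c.ε x.1 x.2))

@[simp] theorem ofFun_toFun (c : NetworkCode I O R μ) : ofFun c.toFun = c := rfl

end NetworkCode

namespace MulticastProblem

variable {V I O : Type*} [DecidableEq V] [Fintype I] [DecidableEq I] [Fintype O] [DecidableEq O]

/-- The Edmonds matrix of a destination `T`: it maps `(yI, yO, x)` to the defects of the flow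
equations followed by the output of `T`. -/
def edmondsMatrix {R : Type*} [CommRing R] (P : MulticastProblem V I O)
    (c : NetworkCode I O R P.rate) (T : V) :
    Matrix (I ⊕ O ⊕ Fin P.rate) (I ⊕ O ⊕ Fin P.rate) R :=
  Matrix.of fun a b => match a, b with
    | .inl i, .inl i' => if i = i' then 1 else 0
    | .inl i, .inr (.inl o) => if (o, i) ∈ P.edges then -1 else 0
    | .inl _, .inr (.inr _) => 0
    | .inr (.inl o), .inl i => if P.inNode i = P.outNode o then -c.β i o else 0
    | .inr (.inl o), .inr (.inl o') => if o = o' then 1 else 0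
    | .inr (.inl o), .inr (.inr k) => if P.outNode o = P.source then -c.α k o else 0
    | .inr (.inr k), .inl i => if P.inNode i = T then c.ε i k else 0
    | .inr (.inr _), .inr (.inl _) => 0
    | .inr (.inr _), .inr (.inr _) => 0

section Field

variable {K : Type*} [Field K] {P : MulticastProblem V I O} {c : NetworkCode I O K P.rate}

theorem edmondsMatrix_mulVec_inl (T : V) (yI : I → K) (yO : O → K) (x : Fin P.rate → K) (i : I) :
    (P.edmondsMatrix c T *ᵥ Sum.elim yI (Sum.elim yO x)) (.inl i) =
      yI i - ∑ o with (o, i) ∈ P.edges, yO o := by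
  have h : ∑ o, (if (o, i) ∈ P.edges then -1 else 0) * yO o =
      -∑ o with (o, i) ∈ P.edges, yO o := by
    rw [Finset.sum_filter, ← Finset.sum_neg_distrib]
    exact Finset.sum_congr rfl fun _ _ => by split_ifs <;> simp
  simp only [Matrix.mulVec, dotProduct, edmondsMatrix, Fintype.sum_sum_type, Matrix.of_apply,
    Sum.elim_inl, Sum.elim_inr, h]
  simp [sub_eq_add_neg]

theorem edmondsMatrix_mulVec_inr_inl (T : V) (yI : I → K) (yO : O → K) (x : Fin P.rate → K)
    (o : O) :
    (P.edmondsMatrix c T *ᵥ Sum.elim yI (Sum.elim yO x)) (.inr (.inl o)) =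
      yO o - ((∑ i with P.inNode i = P.outNode o, c.β i o * yI i) +
        (if P.outNode o = P.source then ∑ k, c.α k o * x k else 0)) := by
  have h : ∑ i, (if P.inNode i = P.outNode o then -c.β i o else 0) * yI i =
      -∑ i with P.inNode i = P.outNode o, c.β i o * yI i := by
    rw [Finset.sum_filter, ← Finset.sum_neg_distrib]
    exact Finset.sum_congr rfl fun _ _ => by split_ifs <;> simp
  have h' : ∑ k, (if P.outNode o = P.source then -c.α k o else 0) * x k =
      -(if P.outNode o = P.source then ∑ k, c.α k o * x k else 0) := by
    split_ifs <;> simp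
  simp only [Matrix.mulVec, dotProduct, edmondsMatrix, Fintype.sum_sum_type, Matrix.of_apply,
    Sum.elim_inl, Sum.elim_inr, h, h']
  simp
  ring

theorem edmondsMatrix_mulVec_inr_inr (T : V) (yI : I → K) (yO : O → K) (x : Fin P.rate → K)
    (k : Fin P.rate) :
    (P.edmondsMatrix c T *ᵥ Sum.elim yI (Sum.elim yO x)) (.inr (.inr k)) =
      P.output c T yI k := by
  simp [Matrix.mulVec, dotProduct, edmondsMatrix, Finset.sum_filter, ite_mul, output]

theorem edmondsMatrix_mulVec_eq_iff (T : V) (yI : I → K) (yO : O → K) (x z : Fin P.rate → K) :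
    P.edmondsMatrix c T *ᵥ Sum.elim yI (Sum.elim yO x) = Sum.elim (0 : I → K) (Sum.elim (0 : O → K) z) ↔
      P.IsFlow c x yI yO ∧ P.output c T yI = z := by
  simp only [funext_iff, Sum.forall, edmondsMatrix_mulVec_inl, edmondsMatrix_mulVec_inr_inl,
    edmondsMatrix_mulVec_inr_inr, Sum.elim_inl, Sum.elim_inr, Pi.zero_apply, sub_eq_zero, IsFlow,
    and_assoc]

/-- In an acyclic network, if the source symbols vanish then all port symbols do. -/
theorem IsFlow.eq_zero (hP : P.toADTNetwork.Acyclic) {yI : I → K} {yO : O → K}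
    (h : P.IsFlow c 0 yI yO) : yI = 0 ∧ yO = 0 := by
  let r : O → O → Prop := fun o' o => ∃ i, (o', i) ∈ P.edges ∧ P.inNode i = P.outNode o
  -- A cycle of output ports under `r` would project to a cycle of supernodes.
  have hr : WellFounded (Relation.TransGen r) := by
    have : Std.Irrefl (Relation.TransGen r) := ⟨fun o ho =>
      hP _ (ho.lift P.outNode fun a b ⟨i, hi, hib⟩ => ⟨(a, i), hi, rfl, hib⟩)⟩
    exact Finite.wellFounded_of_trans_of_irrefl _
  have hO : ∀ o, yO o = 0 := fun o => by
    induction o using hr.induction with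
    | _ o ih =>
      rw [h.2 o]
      simp only [Pi.zero_apply, mul_zero, Finset.sum_const_zero, ite_self, add_zero]
      refine Finset.sum_eq_zero fun i hi => ?_
      rw [h.1 i, Finset.sum_eq_zero, mul_zero]
      exact fun o' ho' => ih o' (.single ⟨i, (Finset.mem_filter.1 ho').2, (Finset.mem_filter.1 hi).2⟩)
  refine ⟨funext fun i => ?_, funext hO⟩
  rw [h.1 i, Finset.sum_eq_zero fun o _ => hO o, Pi.zero_apply]

/-- A kernel vector is a flow with zero output at `T`. Correct decoding forces its source vector to
vanish, and acyclicity then kills all port symbols. -/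
theorem Establishes.det_edmondsMatrix_ne_zero (hP : P.toADTNetwork.Acyclic)
    (hc : P.Establishes c) {T : V} (hT : T ∈ P.dests) : (P.edmondsMatrix c T).det ≠ 0 := by
  rw [Ne, ← Matrix.exists_mulVec_eq_zero_iff]
  rintro ⟨v, hv, hv0⟩
  obtain ⟨yI, yO, x, rfl⟩ : ∃ yI yO x, v = Sum.elim yI (Sum.elim yO x) :=
    ⟨fun i => v (.inl i), fun o => v (.inr (.inl o)), fun k => v (.inr (.inr k)), by
      ext (_ | _ | _) <;> rfl⟩
  obtain ⟨hf, hz⟩ := (edmondsMatrix_mulVec_eq_iff T yI yO x 0).1 <| by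
    rw [hv0]; ext (_ | _ | _) <;> rfl
  obtain rfl : x = 0 := ((hc x).2 yI yO hf T hT).symm.trans hz
  obtain ⟨rfl, rfl⟩ := hf.eq_zero hP
  exact hv (by ext (_ | _ | _) <;> rfl)

/-- If the Edmonds matrix of a destination is invertible then that destination can decode. -/
theorem exists_decoder_of_det_ne_zero (hP : P.toADTNetwork.Acyclic) {T : V}
    (hdet : (P.edmondsMatrix c T).det ≠ 0) :
    ∃ D : Matrix (Fin P.rate) (Fin P.rate) K,
      ∀ x, (∃ yI yO, P.IsFlow c x yI yO) ∧
        ∀ yI yO, P.IsFlow c x yI yO → Matrix.vecMul (P.output c T yI) D = x := by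
  have hu : IsUnit (P.edmondsMatrix c T).det := hdet.isUnit
  -- The block of the inverse that sends the output of `T` back to the source vector.
  let N : Matrix (Fin P.rate) (Fin P.rate) K :=
    (P.edmondsMatrix c T)⁻¹.submatrix (fun k => .inr (.inr k)) (fun k => .inr (.inr k))
  have hN : ∀ x yI yO, P.IsFlow c x yI yO → N *ᵥ P.output c T yI = x := fun x yI yO h => by
    have h1 := (edmondsMatrix_mulVec_eq_iff T yI yO x _).2 ⟨h, rfl⟩
    apply_fun ((P.edmondsMatrix c T)⁻¹ *ᵥ ·) at h1
    simp only [Matrix.mulVec_mulVec, Matrix.nonsing_inv_mul _ hu, Matrix.one_mulVec] at h1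
    funext k
    have h2 := congrFun h1 (.inr (.inr k))
    simp only [Sum.elim_inr] at h2
    rw [h2]
    simp [N, Matrix.mulVec, dotProduct]
  refine ⟨Nᵀ, fun x => ⟨?_, fun yI yO h => by rw [Matrix.vecMul_transpose, hN x yI yO h]⟩⟩
  have hflow : ∀ z, ∃ yI yO, P.IsFlow c (N *ᵥ z) yI yO ∧ P.output c T yI = z := fun z => by
    let v := (P.edmondsMatrix c T)⁻¹ *ᵥ Sum.elim (0 : I → K) (Sum.elim (0 : O → K) z)
    have hv : v = Sum.elim (fun i => v (.inl i))
        (Sum.elim (fun o => v (.inr (.inl o))) (N *ᵥ z)) := by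
      ext (_ | _ | k)
      · rfl
      · rfl
      · simp [v, N, Matrix.mulVec, dotProduct]
    refine ⟨fun i => v (.inl i), fun o => v (.inr (.inl o)),
      (edmondsMatrix_mulVec_eq_iff T _ _ _ z).1 ?_⟩
    rw [← hv]
    simp [v, Matrix.mulVec_mulVec, Matrix.mul_nonsing_inv _ hu]
  -- If `N *ᵥ z = 0`, then `z` is the output of a flow with zero source, hence zero. So `N` is also
  -- surjective, and every source vector admits a flow.
  have hinj : Function.Injective N.mulVecLin := by
    rw [← LinearMap.ker_eq_bot, LinearMap.ker_eq_bot']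
    intro z hz
    obtain ⟨yI, yO, h, hout⟩ := hflow z
    rw [← Matrix.mulVecLin_apply, hz] at h
    obtain ⟨rfl, -⟩ := h.eq_zero hP
    rw [← hout]
    ext k
    simp [output]
  obtain ⟨z, rfl⟩ := LinearMap.surjective_of_injective hinj x
  obtain ⟨yI, yO, h, -⟩ := hflow z
  exact ⟨yI, yO, h⟩

end Field

omit [DecidableEq V] [Fintype I] [Fintype O] in
theorem Acyclic.fail {P : MulticastProblem V I O} (hP : P.toADTNetwork.Acyclic)
    (f : Finset (O × I)) : (P.fail f).toADTNetwork.Acyclic := fun v hv =>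
  hP v (hv.lift id fun _ _ ⟨e, he, h⟩ => ⟨e, (Finset.mem_sdiff.1 he).1, h⟩)

theorem map_det_edmondsMatrix_ofFun {R S : Type*} [CommRing R] [CommRing S] (φ : R →+* S)
    (P : MulticastProblem V I O) (a : CodeVar I O P.rate → R) (T : V) :
    φ (P.edmondsMatrix (.ofFun a) T).det = (P.edmondsMatrix (.ofFun (φ ∘ a)) T).det := by
  rw [RingHom.map_det]
  congr 1
  ext (_ | _ | _) (_ | _ | _) <;> simp [edmondsMatrix, NetworkCode.ofFun, apply_ite φ]

/-- The determinant of the Edmonds matrix of the generic code. -/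
noncomputable def edmondsPoly (R : Type*) [CommRing R] (P : MulticastProblem V I O) (T : V) :
    MvPolynomial (CodeVar I O P.rate) R :=
  (P.edmondsMatrix (.ofFun MvPolynomial.X) T).det

theorem eval₂_edmondsPoly {R S : Type*} [CommRing R] [CommRing S] (φ : R →+* S)
    (P : MulticastProblem V I O) (a : CodeVar I O P.rate → S) (T : V) :
    MvPolynomial.eval₂Hom φ a (P.edmondsPoly R T) = (P.edmondsMatrix (.ofFun a) T).det := by
  rw [edmondsPoly, map_det_edmondsMatrix_ofFun]
  congr
  ext v
  simp

theorem map_edmondsPoly {R S : Type*} [CommRing R] [CommRing S] (φ : R →+* S)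
    (P : MulticastProblem V I O) (T : V) :
    MvPolynomial.map φ (P.edmondsPoly R T) = P.edmondsPoly S T := by
  rw [edmondsPoly, map_det_edmondsMatrix_ofFun, edmondsPoly]
  congr
  ext1 v
  simp

theorem degreeOf_edmondsPoly_le {R : Type*} [CommRing R] [Nontrivial R]
    (P : MulticastProblem V I O) (T : V) (v : CodeVar I O P.rate) :
    (P.edmondsPoly R T).degreeOf v ≤ 1 := by
  refine MvPolynomial.degreeOf_det_le_one _ v
    (match v with
      | .inl (_, o) => .inr (.inl o)
      | .inr (.inl (_, o)) => .inr (.inl o)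
      | .inr (.inr (_, k)) => .inr (.inr k)) ?_
  rintro (_ | _ | _) (_ | _ | _) <;> rcases v with (⟨_, _⟩ | ⟨_, _⟩ | ⟨_, _⟩) <;>
    simp only [edmondsMatrix, NetworkCode.ofFun, Matrix.of_apply] <;> split_ifs <;>
    simp_all [MvPolynomial.degreeOf_X, MvPolynomial.degreeOf_neg, MvPolynomial.degreeOf_one] <;>
    grind

/-- Solvability over a field of characteristic `p` makes the generic determinants nonzero over
every field of characteristic `p`. -/
theorem Solvable.edmondsPoly_ne_zero {P : MulticastProblem V I O} (hP : P.toADTNetwork.Acyclic)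
    {p : ℕ} (hp : p.Prime) {L : Type*} [Field L] [CharP L p] (h : P.Solvable L)
    (K : Type*) [Field K] [CharP K p] {T : V} (hT : T ∈ P.dests) : P.edmondsPoly K T ≠ 0 := by
  have : Fact p.Prime := ⟨hp⟩
  obtain ⟨c, hc⟩ := h
  -- The prime field lies in both `L` and `K`: nonvanishing descends from a value in `L`, then
  -- passes up to `K`.
  have h0 : P.edmondsPoly (ZMod p) T ≠ 0 := fun h0 => by
    have := eval₂_edmondsPoly (ZMod.castHom dvd_rfl L) P c.toFun T
    rw [h0, map_zero, NetworkCode.ofFun_toFun] at this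
    exact hc.det_edmondsMatrix_ne_zero hP hT this.symm
  rw [← map_edmondsPoly (ZMod.castHom dvd_rfl K)]
  rwa [Ne, map_eq_zero_iff _ (MvPolynomial.map_injective _ (ZMod.castHom dvd_rfl K).injective)]

theorem edmondsPoly_ne_zero_of_mem_solvableFailuresChar {P : MulticastProblem V I O}
    (hP : P.toADTNetwork.Acyclic) {p : ℕ} (hp : p.Prime) (K : Type*) [Field K] [CharP K p] :
    ∀ f ∈ P.solvableFailuresChar p, ∀ T ∈ P.dests, (P.fail f).edmondsPoly K T ≠ 0 := by
  rintro f ⟨-, L, _, _, _, hL⟩ T hT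
  exact hL.edmondsPoly_ne_zero (Acyclic.fail hP f) hp K hT

/-- If all generic determinants are nonzero and the field is large enough, some code works for all
failure patterns at once. -/
theorem exists_isStaticSolution {P : MulticastProblem V I O} (hP : P.toADTNetwork.Acyclic)
    {K : Type*} [Field K] [Finite K] {𝓕 : Set (Finset (O × I))}
    (h : ∀ f ∈ 𝓕, ∀ T ∈ P.dests, (P.fail f).edmondsPoly K T ≠ 0)
    (hK : 𝓕.ncard * P.dests.card < Nat.card K) :
    ∃ c : NetworkCode I O K P.rate, P.IsStaticSolution 𝓕 c := by
  have := Fintype.ofFinite K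
  have h𝓕 : 𝓕.Finite := 𝓕.toFinite
  let Q : MvPolynomial (CodeVar I O P.rate) K :=
    ∏ e ∈ h𝓕.toFinset ×ˢ P.dests, (P.fail e.1).edmondsPoly K e.2
  have hQ : Q ≠ 0 := Finset.prod_ne_zero_iff.2 fun e he => by
    rw [Finset.mem_product, Set.Finite.mem_toFinset] at he
    exact h e.1 he.1 e.2 he.2
  have hdeg : ∀ v, Q.degreeOf v < (Finset.univ : Finset K).card := fun v => by
    rw [Finset.card_univ, ← Nat.card_eq_fintype_card]
    refine lt_of_le_of_lt ?_ hK
    refine (MvPolynomial.degreeOf_prod_le v _ _).trans ?_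
    refine (Finset.sum_le_card_nsmul _ _ 1 fun e _ =>
      degreeOf_edmondsPoly_le (P.fail e.1) e.2 v).trans ?_
    rw [Finset.card_product, Set.ncard_eq_toFinset_card 𝓕 h𝓕, smul_eq_mul, mul_one]
  obtain ⟨a, ha⟩ : ∃ a, MvPolynomial.eval a Q ≠ 0 := by
    by_contra! h0
    exact hQ (MvPolynomial.eq_zero_of_eval_zero_at_prod_finset Q (fun _ => Finset.univ) hdeg
      fun a _ => h0 a)
  refine ⟨.ofFun a, fun f hf T hT => exists_decoder_of_det_ne_zero (Acyclic.fail hP f) ?_⟩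
  rw [map_prod, Finset.prod_ne_zero_iff] at ha
  have := ha (f, T) (Finset.mem_product.2 ⟨h𝓕.mem_toFinset.2 hf, hT⟩)
  rwa [← eval₂_edmondsPoly (RingHom.id K) (P.fail f)]

end MulticastProblem

theorem mainTheorem9 {V I O : Type*} [DecidableEq V]
    [Fintype I] [DecidableEq I] [Fintype O] [DecidableEq O]
    (P : MulticastProblem V I O) (hP : P.toADTNetwork.Acyclic) (p : ℕ) (hp : p.Prime) :
    (∃ (K : Type) (_ : Field K) (_ : Finite K) (_ : CharP K p)
      (c : NetworkCode I O K P.rate), P.IsStaticSolution (P.solvableFailuresChar p) c) ∧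
    (∀ (K : Type*) [Field K] [Finite K] [CharP K p],
      (P.solvableFailuresChar p).ncard * P.dests.card < Nat.card K →
        ∃ c : NetworkCode I O K P.rate, P.IsStaticSolution (P.solvableFailuresChar p) c) ∧
    (∀ (K : Type*) [Field K] [Finite K] [CharP K p],
      (P.solvableFailures K).ncard * P.dests.card < Nat.card K →
        ∃ c : NetworkCode I O K P.rate, P.IsStaticSolution (P.solvableFailures K) c) := by
  have : Fact p.Prime := ⟨hp⟩
  refine ⟨?_, fun K _ _ _ hK =>
    MulticastProblem.exists_isStaticSolution hP
      (MulticastProblem.edmondsPoly_ne_zero_of_mem_solvableFailuresChar hP hp K) hK,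
    fun K _ _ _ hK => ?_⟩
  -- The `+ 1` makes the extension degree nonzero, and `p ^ n > n` gives the required size.
  · let n := (P.solvableFailuresChar p).ncard * P.dests.card + 1
    refine ⟨GaloisField p n, inferInstance, inferInstance, inferInstance,
      MulticastProblem.exists_isStaticSolution hP
        (MulticastProblem.edmondsPoly_ne_zero_of_mem_solvableFailuresChar hP hp _) ?_⟩
    rw [GaloisField.card p n (Nat.succ_ne_zero _)]
    exact (Nat.lt_succ_self _).trans (Nat.lt_pow_self hp.one_lt)
  · refine MulticastProblem.exists_isStaticSolution hP ?_ hK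
    rintro f ⟨-, hf⟩ T hT
    exact hf.edmondsPoly_ne_zero (MulticastProblem.Acyclic.fail hP f) hp K hT
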